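/- For each $I\ge 1$ consider a matched study with $I$ matched sets; everything below may depend on $I$. Set $i$ has $n_i\ge 2$ units $(i,j)$ with fixed real potential outcomes $Y_{ij}(1),Y_{ij}(0)$. Exactly one unit of each set is treated ($Z_{ij}\in\{0,1\}$, $\sum_j Z_{ij}=1$), the assignments are independent across sets, and $p^\star_{ij}=\mathbb P(Z_{ij}=1)$. The hidden bias of set $i$ is $\Gamma_i^\star=\max_j p^\star_{ij}/\min_k p^\star_{ik}\in[1,\infty]$ (with $\Gamma_i^\star=\infty$ if some $p^\star_{ik}=0$). Assume Fisher's null hypothesis $Y_{ij}(1)=Y_{ij}(0)$ for all $i,j$. The test statistic is $T=\sum_{i=1}^I T_i$, $T_i=\sum_{j=1}^{n_i}Z_{ij}q_{ij}$, where the $q_{ij}$ are arbitrary real functions of the outcome vector (which under the null is $Y(0)$). For $\Gamma=(\Gamma_1,\dots,\Gamma_I)\in[1,\infty]^I$ and $u_{ij}\in[0,1]$, let $\mathcal M(\Gamma,u)$ be the model in which the sets are independent and unit $j$ of set $i$ is treated with probability $\Gamma_i^{u_{ij}}/\sum_k\Gamma_i^{u_{ik}}$ (if $\Gamma_i=\infty$,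 the assignment probabilities of set $i$ are arbitrary). Let $\mu(\Gamma)$ be the maximum of the mean of $T$ over all these models with $u$ ranging over $[0,1]^N$, $N=\sum_i n_i$, and let $\sigma^2(\Gamma)$ be the maximum of the variance of $T$ over those models for which the mean equals $\mu(\Gamma)$. Let $\mu_i(\Gamma_i)$ and $v_i^2(\Gamma_i)$ be the corresponding quantities for $T_i$ alone, let $\mu_i$ and $v_i^2$ be the true mean and variance of $T_i$, and put $$R_i=\max_j q_{ij}-\min_j q_{ij},\qquad S_I=\sum_{i=1}^I\frac{R_i^2}{(n_i\Gamma_i^\star)^3},\qquad \mathcal A_\Gamma=\{i: v_i^2>v_i^2(\Gamma_i)\},$$ $$\Delta_\mu(\Gamma)=\frac1{|\mathcal A_\Gamma|}\sum_{i\in\mathcal A_\Gamma}\{\mu_i(\Gamma_i)-\mu_i\},\qquad \Delta_{v^2}(\Gamma)=\frac1{|\mathcal A_\Gamma|}\sum_{i\in\mathcal A_\Gamma}\{v_i^2-v_i^2(\Gamma_i)\},$$ where a set with $\Gamma_i^\star=\infty$ contributes $0$ to $S_I$ and $\Delta_\mu(\Gamma)/\Delta_{v^2}(\Gamma)$ is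 taken to be $\infty$ if $\mathcal A_\Gamma=\emptyset$. Suppose that $\Gamma_i^\star\le\Gamma_i$ for all $i$ and that, as $I\to\infty$, (A1) $S_I>0$ for all large $I$ and $\max_{1\le i\le I}R_i^2/S_I\to0$; (A2) $\{\Delta_\mu(\Gamma)/\Delta_{v^2}(\Gamma)\}\cdot\sqrt{S_I}\to\infty$. Then for every $c\ge0$, $$\limsup_{I\to\infty}\mathbb P\{T\ge\mu(\Gamma)+c\,\sigma(\Gamma)\}\le 1-\Phi(c),$$ where $\Phi$ is the standard Gaussian distribution function. Moreover, for each $I$ with $\sigma(\Gamma)>0$, a random variable $\tilde T(\Gamma)\sim\mathcal N(\mu(\Gamma),\sigma^2(\Gamma))$ satisfies $\mathbb P\{\tilde T(\Gamma)\ge\mu(\Gamma)+c\,\sigma(\Gamma)\}=1-\Phi(c)$. -/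

import Mathlib

open Filter Topology MeasureTheory ProbabilityTheory
open scoped ENNReal

noncomputable section

/-- A matched observational study with `I` matched sets, seen as a finite population.
Set `i` consists of the `n i ≥ 2` units `(i, j)`. The potential outcomes are fixed constants and
the only randomness is the treatment assignment, conditionally on the event that every matched
set has exactly one treated unit. -/
structure MatchedStudy (I : ℕ) where
  /-- the number of units in each matched set -/
  n : Fin I → ℕ
  two_le_n : ∀ i, 2 ≤ n i
  /-- the potential outcomes under treatment -/
  Y1 : (i : Fin I) → Fin (n i) → ℝ
  /-- the potential outcomes under control -/
  Y0 : (i : Fin I) → Fin (n i) → ℝ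
  /-- the scores `q i j` of the test statistic, arbitrary functions of the whole outcome vector -/
  q : ((i : Fin I) → Fin (n i) → ℝ) → (i : Fin I) → Fin (n i) → ℝ
  /-- the true assignment probabilities: `p i j` is the probability that unit `j` is the treated
  unit of set `i`, given that this set has exactly one treated unit -/
  p : (i : Fin I) → PMF (Fin (n i))

/-- The assignments with exactly one treated unit in each set: `z i` is the treated unit
of set `i`. -/
abbrev Assignment {I : ℕ} (n : Fin I → ℕ) : Type := (i : Fin I) → Fin (n i)

/-- The indicator that unit `j` of a set is treated when `k` is the treated unit of that set. -/
def treated {m : ℕ} (k j : Fin m) : ℝ := if k = j then 1 else 0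

/-- The law of the assignment when the sets are mutually independent and `p i` is the law of the
treated unit of set `i`, that is, `ℙ(Z = z) = ∏ i, p i (z i)`. -/
def assignmentLaw {I : ℕ} {n : Fin I → ℕ} (p : (i : Fin I) → PMF (Fin (n i))) :
    Measure (Assignment n) :=
  Measure.pi fun i => (p i).toMeasure

/-- The hidden bias `max_j p j / min_k p k ∈ [1, ∞]` of one matched set; it is `∞` exactly when
some unit has probability zero of being treated. -/
def hiddenBias {m : ℕ} (p : PMF (Fin m)) : ℝ≥0∞ := (⨆ j, p j) / (⨅ k, p k)

/-- The sensitivity model for one matched set, with bias `Γ ∈ [1, ∞]` and hidden confounder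
`u`: unit `j` is treated with probability `exp (γ u_j) / ∑ k, exp (γ u_k)` where `γ = log Γ`.
With `Γ = ∞` the model does not restrict the assignment probabilities, which may then
be 0 or 1. -/
def SetModel {m : ℕ} (Γ : ℝ≥0∞) (u : Fin m → ℝ) (p : PMF (Fin m)) : Prop :=
  Γ ≠ ∞ → ∀ j, (p j).toReal =
    Real.exp (Real.log Γ.toReal * u j) / ∑ k, Real.exp (Real.log Γ.toReal * u k)

/-- The sensitivity model `M(Γ, u)` for all matched sets. -/
def SensitivityModel {I : ℕ} {n : Fin I → ℕ} (Γ : Fin I → ℝ≥0∞)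
    (u : (i : Fin I) → Fin (n i) → ℝ) (p : (i : Fin I) → PMF (Fin (n i))) : Prop :=
  ∀ i, SetModel (Γ i) (u i) (p i)

namespace MatchedStudy

variable {I : ℕ} (S : MatchedStudy I)

/-- Fisher's null hypothesis of no effect for any unit. -/
def FisherNull : Prop := ∀ i j, S.Y0 i j = S.Y1 i j

/-- The observed outcomes under the assignment `z`. -/
def observed (z : Assignment S.n) (i : Fin I) (j : Fin (S.n i)) : ℝ :=
  treated (z i) j * S.Y1 i j + (1 - treated (z i) j) * S.Y0 i j

/-- The statistic of set `i`, computed from the outcomes `y`, when `k` is the treated unit. -/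
def setStat (y : (i : Fin I) → Fin (S.n i) → ℝ) (i : Fin I) (k : Fin (S.n i)) : ℝ :=
  ∑ j, treated k j * S.q y i j

/-- The statistic `t(z, y) = ∑ i, ∑ j, z_ij q_ij(y)`. -/
def stat (z : Assignment S.n) (y : (i : Fin I) → Fin (S.n i) → ℝ) : ℝ :=
  ∑ i, S.setStat y i (z i)

/-- The test statistic `T`, computed from the observed outcomes. -/
def T (z : Assignment S.n) : ℝ := S.stat z (S.observed z)

/-- The true law of the treatment assignment. -/
def law : Measure (Assignment S.n) := assignmentLaw S.p

/-- `𝔼 t(Z, Y(0))` when the sets are independent with assignment probabilities `p`. -/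
def mean (p : (i : Fin I) → PMF (Fin (S.n i))) : ℝ :=
  ∫ z, S.stat z S.Y0 ∂(assignmentLaw p)

/-- `Var t(Z, Y(0))` when the sets are independent with assignment probabilities `p`. -/
def var (p : (i : Fin I) → PMF (Fin (S.n i))) : ℝ :=
  variance (fun z => S.stat z S.Y0) (assignmentLaw p)

/-- `μ(Γ)`: the maximal mean of `t(Z, Y(0))` over the models `M(Γ, u)`, `u ∈ [0,1]^N`. -/
def maxMean (Γ : Fin I → ℝ≥0∞) : ℝ :=
  sSup {m | ∃ u p, (∀ i j, u i j ∈ Set.Icc (0 : ℝ) 1) ∧ SensitivityModel Γ u p ∧ m = S.mean p}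

/-- `σ²(Γ)`: the maximal variance of `t(Z, Y(0))` over the models `M(Γ, u)`, `u ∈ [0,1]^N`,
under which the mean is maximal. -/
def maxVar (Γ : Fin I → ℝ≥0∞) : ℝ :=
  sSup {v | ∃ u p, (∀ i j, u i j ∈ Set.Icc (0 : ℝ) 1) ∧ SensitivityModel Γ u p ∧
    S.mean p = S.maxMean Γ ∧ v = S.var p}

/-- The mean of the statistic `T_i` of set `i` (computed from `Y(0)`) under `p`. -/
def setMean (i : Fin I) (p : PMF (Fin (S.n i))) : ℝ :=
  ∫ k, S.setStat S.Y0 i k ∂p.toMeasure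

/-- The variance of the statistic `T_i` of set `i` (computed from `Y(0)`) under `p`. -/
def setVar (i : Fin I) (p : PMF (Fin (S.n i))) : ℝ :=
  variance (S.setStat S.Y0 i) p.toMeasure

/-- `μ_i(Γ_i)`: the maximal mean of `T_i` when the bias of set `i` is bounded by `Γ`. -/
def setMaxMean (i : Fin I) (Γ : ℝ≥0∞) : ℝ :=
  sSup {m | ∃ u p, (∀ j, u j ∈ Set.Icc (0 : ℝ) 1) ∧ SetModel Γ u p ∧ m = S.setMean i p}

/-- `v_i²(Γ_i)`: the maximal variance of `T_i`, given that its mean is maximal, when the bias of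
set `i` is bounded by `Γ`. -/
def setMaxVar (i : Fin I) (Γ : ℝ≥0∞) : ℝ :=
  sSup {v | ∃ u p, (∀ j, u j ∈ Set.Icc (0 : ℝ) 1) ∧ SetModel Γ u p ∧
    S.setMean i p = S.setMaxMean i Γ ∧ v = S.setVar i p}

/-- `R_i = max_j q_ij - min_j q_ij`. -/
def range (i : Fin I) : ℝ := (⨆ j, S.q S.Y0 i j) - ⨅ j, S.q S.Y0 i j

/-- `∑ i, R_i² / (n_i Γ_i⋆)³`, where a set with infinite hidden bias contributes 0. -/
def rangeSum : ℝ :=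
  ∑ i, S.range i ^ 2 * ((((S.n i : ℝ≥0∞) * hiddenBias (S.p i)) ^ 3)⁻¹).toReal

/-- `A_Γ`: the sets whose true variance exceeds the maximized variance. -/
def excess (Γ : Fin I → ℝ≥0∞) : Set (Fin I) :=
  {i | S.setMaxVar i (Γ i) < S.setVar i (S.p i)}

open Classical in
/-- `Δ_μ(Γ)`: the average over `A_Γ` of `μ_i(Γ_i) - μ_i`. -/
def deltaMean (Γ : Fin I → ℝ≥0∞) : ℝ :=
  (((S.excess Γ).toFinset.card : ℝ))⁻¹ *
    ∑ i ∈ (S.excess Γ).toFinset, (S.setMaxMean i (Γ i) - S.setMean i (S.p i))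

open Classical in
/-- `Δ_{v²}(Γ)`: the average over `A_Γ` of `v_i² - v_i²(Γ_i)`. -/
def deltaVar (Γ : Fin I → ℝ≥0∞) : ℝ :=
  (((S.excess Γ).toFinset.card : ℝ))⁻¹ *
    ∑ i ∈ (S.excess Γ).toFinset, (S.setVar i (S.p i) - S.setMaxVar i (Γ i))

open Classical in
/-- The ratio `Δ_μ(Γ) / Δ_{v²}(Γ)`, which is `∞` when `A_Γ` is empty. -/
def deltaRatio (Γ : Fin I → ℝ≥0∞) : EReal :=
  if S.excess Γ = ∅ then ⊤ else ((S.deltaMean Γ / S.deltaVar Γ : ℝ) : EReal)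

end MatchedStudy

/-- The Lindeberg-type condition `max_i R_i² / ∑ i, R_i² / (n_i Γ_i⋆)³ → 0`; that the ratio is
defined, i.e. has a nonzero denominator for large `I`, is part of the condition. -/
def ConditionA1 (S : (I : ℕ) → MatchedStudy I) : Prop :=
  (∀ᶠ I in atTop, 0 < (S I).rangeSum) ∧
    Tendsto (fun I => (⨆ i, (S I).range i ^ 2) / (S I).rangeSum) atTop (𝓝 0)

/-- The condition `Δ_μ(Γ) / Δ_{v²}(Γ) * √(∑ i, R_i² / (n_i Γ_i⋆)³) → ∞`. -/
def ConditionA2 (S : (I : ℕ) → MatchedStudy I) (Γ : (I : ℕ) → Fin I → ℝ≥0∞) : Prop :=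
  Tendsto (fun I => (S I).deltaRatio (Γ I) * ((Real.sqrt (S I).rangeSum : ℝ) : EReal))
    atTop (𝓝 ⊤)

end

/-! The statistic is standardized by its true mean `μ` and standard deviation `s`, and the bounds
`μ(Γ)`, `σ(Γ)` enter only through a deterministic inequality.

Asymptotic normality: in each set, every unit has probability at least `1 / (n_i Γ_i⋆)`, so the
variance of `T_i` is at least its term in `S_I` (`sq_range_mul_le_setVar`). Hence `s² ≥ S_I`, and
(A1) makes the standardized summands uniformly small. A characteristic function estimate
(`norm_integral_cexp_sum_sub_le`) then gives the normal limit.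

Comparison: the rejection event forces `(T - μ) / s ≥ c` as soon as `c s ≤ μ(Γ) - μ + c σ(Γ)`
(`mul_sqrt_var_le`). Maximal means add up over sets, and each true mean is at most its maximum
because the true law belongs to the model. If `s > σ(Γ)`, then `c (s - σ(Γ)) ≤ c (s² - σ²(Γ)) / s`.
The variance excess over `A_Γ` bounds the numerator, and (A2) with `√S_I ≤ s` lets the mean excess
over `A_Γ` absorb the quotient. -/

/-- The real measure of an upper half-line under the standard normal law. -/
theorem gaussianReal_zero_one_real_Ici (c : ℝ) :
    (gaussianReal 0 1).real (Set.Ici c) = 1 - cdf (gaussianReal 0 1) c := by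
  have := nullSingletonClass_gaussianReal (μ := 0) (v := 1) one_ne_zero
  rw [cdf_eq_real, ← Set.compl_Iio, probReal_compl_eq_one_sub measurableSet_Iio]
  congr 1
  exact measureReal_congr Iio_ae_eq_Iic

theorem gaussianReal_real_upper_tail (m : ℝ) {s : ℝ} (hs : 0 < s) (c : ℝ) :
    (gaussianReal m s.toNNReal).real {t | t ≥ m + c * Real.sqrt s}
      = 1 - cdf (gaussianReal 0 1) c := by
  have hmap : gaussianReal m s.toNNReal
      = (gaussianReal 0 1).map (fun x => m + Real.sqrt s * x) := by
    have h1 : (fun x : ℝ => m + Real.sqrt s * x) = (fun x => m + x) ∘ (fun x => Real.sqrt s * x) :=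
      rfl
    rw [h1, ← Measure.map_map (by fun_prop) (by fun_prop), gaussianReal_map_const_mul,
      gaussianReal_map_const_add]
    congr 1
    · simp
    · ext
      simp [Real.sq_sqrt hs.le, Real.coe_toNNReal s hs.le]
  change (gaussianReal m s.toNNReal).real (Set.Ici (m + c * Real.sqrt s)) = _
  rw [hmap, map_measureReal_apply (by fun_prop) measurableSet_Ici,
    ← gaussianReal_zero_one_real_Ici]
  congr 1
  ext x
  have := Real.sqrt_pos.2 hs
  simp only [Set.mem_preimage, Set.mem_Ici]
  rw [mul_comm c, add_le_add_iff_left, mul_le_mul_iff_right₀ this]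

/-! ### Characteristic functions and the central limit theorem -/

/-- Telescoping: replacing one factor at a time costs one difference, since the remaining factors
lie in the unit disc. -/
theorem norm_prod_sub_prod_le {ι : Type*} (s : Finset ι) (a b : ι → ℂ)
    (ha : ∀ i, ‖a i‖ ≤ 1) (hb : ∀ i, ‖b i‖ ≤ 1) :
    ‖∏ i ∈ s, a i - ∏ i ∈ s, b i‖ ≤ ∑ i ∈ s, ‖a i - b i‖ := by
  classical
  induction s using Finset.induction_on with
  | empty => simp
  | insert j s hj ih =>
    rw [Finset.prod_insert hj, Finset.prod_insert hj, Finset.sum_insert hj]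
    have h : a j * ∏ i ∈ s, a i - b j * ∏ i ∈ s, b i
        = (a j - b j) * ∏ i ∈ s, a i + b j * (∏ i ∈ s, a i - ∏ i ∈ s, b i) := by ring
    rw [h]
    refine (norm_add_le _ _).trans (add_le_add ?_ ?_)
    · rw [norm_mul]
      refine mul_le_of_le_one_right (norm_nonneg _) ?_
      rw [norm_prod]
      exact Finset.prod_le_one (fun _ _ => norm_nonneg _) fun i _ => ha i
    · rw [norm_mul]
      exact (mul_le_of_le_one_left (norm_nonneg _) (hb j)).trans ih

/-- Second-order expansion of the characteristic function of a small bounded centred variable. -/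
theorem norm_integral_cexp_sub_le {α : Type*} [MeasurableSpace α] (P : Measure α)
    [IsProbabilityMeasure P] {X : α → ℝ} (hX : Measurable X) {δ : ℝ} (hδ : ∀ a, |X a| ≤ δ)
    (h0 : ∫ a, X a ∂P = 0) {t : ℝ} (ht : |t| * δ ≤ 1) :
    ‖∫ a, Complex.exp ((t * X a : ℝ) * Complex.I) ∂P
        - ((1 - t ^ 2 * (∫ a, X a ^ 2 ∂P) / 2 : ℝ) : ℂ)‖
      ≤ |t| ^ 3 * δ * ∫ a, X a ^ 2 ∂P := by
  have i1 : Integrable X P :=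
    Integrable.of_bound hX.aestronglyMeasurable δ (ae_of_all _ fun a => by simpa using hδ a)
  have i2 : Integrable (fun a => X a ^ 2) P :=
    Integrable.of_bound (hX.pow_const 2).aestronglyMeasurable (δ ^ 2) (ae_of_all _ fun a => by
      rw [Real.norm_eq_abs, abs_pow]
      exact pow_le_pow_left₀ (abs_nonneg _) (hδ a) 2)
  have ie : Integrable (fun a => Complex.exp ((t * X a : ℝ) * Complex.I)) P :=
    Integrable.of_bound (by fun_prop) 1 (ae_of_all _ fun a => by
      rw [Complex.norm_exp_ofReal_mul_I])
  have i1' : Integrable (fun a => ((t * X a : ℝ) : ℂ) * Complex.I) P :=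
    (i1.const_mul t).ofReal.mul_const _
  have i2' : Integrable (fun a => ((1 - t ^ 2 * X a ^ 2 / 2 : ℝ) : ℂ)) P :=
    ((integrable_const 1).sub ((i2.const_mul _).div_const _)).ofReal
  have hval : ∫ a, (((1 - t ^ 2 * X a ^ 2 / 2 : ℝ) : ℂ) + ((t * X a : ℝ) : ℂ) * Complex.I) ∂P
      = ((1 - t ^ 2 * (∫ a, X a ^ 2 ∂P) / 2 : ℝ) : ℂ) := by
    rw [integral_add i2' i1', integral_mul_const, integral_complex_ofReal, integral_complex_ofReal,
      integral_const_mul, h0, integral_sub (integrable_const 1) ((i2.const_mul _).div_const _),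
      integral_div, integral_const_mul]
    simp
  have i3 : Integrable (fun a => ((1 - t ^ 2 * X a ^ 2 / 2 : ℝ) : ℂ)
      + ((t * X a : ℝ) : ℂ) * Complex.I) P := i2'.add i1'
  rw [← hval, ← integral_sub ie i3, ← integral_const_mul]
  refine norm_integral_le_of_norm_le (i2.const_mul _) (ae_of_all _ fun a => ?_)
  have hn : ‖((t * X a : ℝ) : ℂ) * Complex.I‖ = |t| * |X a| := by
    rw [norm_mul, Complex.norm_I, mul_one, Complex.norm_real, Real.norm_eq_abs, abs_mul]
  have hle : |t| * |X a| ≤ 1 :=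
    (mul_le_mul_of_nonneg_left (hδ a) (abs_nonneg t)).trans ht
  have hb := Complex.exp_bound (x := ((t * X a : ℝ) : ℂ) * Complex.I) (hn.trans_le hle)
    (n := 3) (by norm_num)
  have hs : ∑ m ∈ Finset.range 3, (((t * X a : ℝ) : ℂ) * Complex.I) ^ m / (m.factorial : ℂ)
      = ((1 - t ^ 2 * X a ^ 2 / 2 : ℝ) : ℂ) + ((t * X a : ℝ) : ℂ) * Complex.I := by
    simp only [Finset.sum_range_succ, Finset.sum_range_zero, mul_pow, Complex.I_sq]
    push_cast
    simp [Nat.factorial]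
    ring
  rw [hs, hn] at hb
  refine hb.trans ?_
  have hX0 := abs_nonneg (X a)
  have ht3 : 0 ≤ |t| ^ 3 := by positivity
  have hc : ((Nat.succ 3 : ℕ) : ℝ) * (((Nat.factorial 3 : ℕ) : ℝ) * ((3 : ℕ) : ℝ))⁻¹ ≤ 1 := by
    norm_num [Nat.factorial]
  refine (mul_le_of_le_one_right (by positivity) hc).trans ?_
  rw [← sq_abs (X a)]
  -- Only one factor of the cubic remainder is bounded by `δ`; the square is kept, so that the error
  -- is proportional to the variance and can be summed over the sets.
  calc (|t| * |X a|) ^ 3 = |t| ^ 3 * |X a| * |X a| ^ 2 := by ring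
    _ ≤ |t| ^ 3 * δ * |X a| ^ 2 := by gcongr; exact hδ a

/-- A quantitative central limit theorem for characteristic functions of sums of independent,
bounded and centred variables. -/
theorem norm_integral_cexp_sum_sub_le {ι : Type*} [Fintype ι] {α : ι → Type*}
    [∀ i, MeasurableSpace (α i)] (P : ∀ i, Measure (α i)) [∀ i, IsProbabilityMeasure (P i)]
    {X : ∀ i, α i → ℝ} (hX : ∀ i, Measurable (X i)) {δ : ℝ} (hδ : ∀ i a, |X i a| ≤ δ)
    (hδ0 : 0 ≤ δ) (h0 : ∀ i, ∫ a, X i a ∂(P i) = 0) (h1 : ∑ i, ∫ a, X i a ^ 2 ∂(P i) = 1)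
    {t : ℝ} (ht : |t| * δ ≤ 1) :
    ‖∫ z, Complex.exp ((t * ∑ i, X i (z i) : ℝ) * Complex.I) ∂(Measure.pi P)
        - Complex.exp ((-(t ^ 2 / 2) : ℝ))‖
      ≤ |t| ^ 3 * δ + t ^ 4 * δ ^ 2 := by
  set v : ι → ℝ := fun i => ∫ a, X i a ^ 2 ∂(P i) with hv
  have hv0 : ∀ i, 0 ≤ v i := fun i => integral_nonneg fun a => sq_nonneg _
  have hvδ : ∀ i, v i ≤ δ ^ 2 := fun i => by
    have : v i ≤ ∫ _, δ ^ 2 ∂(P i) := by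
      refine integral_mono_of_nonneg (ae_of_all _ fun a => sq_nonneg _) (integrable_const _)
        (ae_of_all _ fun a => ?_)
      exact sq_le_sq' (neg_le_of_abs_le (hδ i a)) (le_of_abs_le (hδ i a))
    simpa using this
  have hprod : ∫ z, Complex.exp ((t * ∑ i, X i (z i) : ℝ) * Complex.I) ∂(Measure.pi P)
      = ∏ i, ∫ a, Complex.exp ((t * X i a : ℝ) * Complex.I) ∂(P i) := by
    rw [← integral_fintype_prod_eq_prod (𝕜 := ℂ)
      (f := fun i a => Complex.exp ((t * X i a : ℝ) * Complex.I))]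
    congr 1 with z
    rw [← Complex.exp_sum, Finset.mul_sum]
    push_cast
    rw [Finset.sum_mul]
  -- The variances sum to one, so the Gaussian limit splits into one factor per summand.
  have hexp : Complex.exp ((-(t ^ 2 / 2) : ℝ))
      = ∏ i, ((Real.exp (-(t ^ 2 * v i / 2)) : ℝ) : ℂ) := by
    rw [← Complex.ofReal_prod, ← Real.exp_sum, ← Complex.ofReal_exp, Finset.sum_neg_distrib,
      ← Finset.sum_div, ← Finset.mul_sum, h1, mul_one]
  rw [hprod, hexp]
  refine (norm_prod_sub_prod_le _ _ _ (fun i => ?_) fun i => ?_).trans ?_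
  · refine (norm_integral_le_of_norm_le_const (C := 1) (ae_of_all _ fun a => ?_)).trans ?_
    · rw [Complex.norm_exp_ofReal_mul_I]
    · simp
  · rw [Complex.norm_real, Real.norm_eq_abs, Real.abs_exp, Real.exp_le_one_iff]
    have := hv0 i
    have : 0 ≤ t ^ 2 * v i / 2 := by positivity
    linarith
  · have hterm : ∀ i, ‖∫ a, Complex.exp ((t * X i a : ℝ) * Complex.I) ∂(P i)
        - ((Real.exp (-(t ^ 2 * v i / 2)) : ℝ) : ℂ)‖ ≤ (|t| ^ 3 * δ + t ^ 4 * δ ^ 2) * v i := by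
      intro i
      have hA := norm_integral_cexp_sub_le (P i) (hX i) (hδ i) (h0 i) ht
      have htδ : t ^ 2 * δ ^ 2 ≤ 1 := by
        have h := pow_le_one₀ (n := 2) (by positivity : 0 ≤ |t| * δ) ht
        rwa [mul_pow, sq_abs] at h
      have hy : t ^ 2 * v i / 2 ≤ 1 := by
        have := mul_le_mul_of_nonneg_left (hvδ i) (sq_nonneg t)
        linarith
      have hy0 : 0 ≤ t ^ 2 * v i / 2 := by have := hv0 i; positivity
      have hB := Real.abs_exp_sub_one_sub_id_le (x := -(t ^ 2 * v i / 2))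
        (by rwa [abs_neg, abs_of_nonneg hy0])
      have hB' : ‖((1 - t ^ 2 * v i / 2 : ℝ) : ℂ)
          - ((Real.exp (-(t ^ 2 * v i / 2)) : ℝ) : ℂ)‖ ≤ t ^ 4 * δ ^ 2 * v i := by
        rw [← Complex.ofReal_sub, Complex.norm_real, Real.norm_eq_abs, abs_sub_comm]
        have h2 : (-(t ^ 2 * v i / 2)) ^ 2 ≤ t ^ 4 * δ ^ 2 * v i := by
          have h3 : t ^ 4 * v i * v i ≤ t ^ 4 * v i * δ ^ 2 :=
            mul_le_mul_of_nonneg_left (hvδ i) (by have := hv0 i; positivity)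
          have h4 : 0 ≤ t ^ 4 * v i * v i := by have := hv0 i; positivity
          nlinarith
        refine le_trans (le_of_eq ?_) (hB.trans h2)
        congr 1
        ring
      refine (norm_sub_le_norm_sub_add_norm_sub _ _ _).trans ((add_le_add hA hB').trans ?_)
      rw [add_mul]
    refine (Finset.sum_le_sum fun i _ => hterm i).trans ?_
    rw [← Finset.mul_sum, h1, mul_one]

/-- Convergence in distribution to the standard normal law bounds the upper tails. -/
theorem limsup_real_tail_le {Q : ℕ → ProbabilityMeasure ℝ}
    (h : ∀ t : ℝ, Tendsto (fun n => charFun (Q n : Measure ℝ) t) atTop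
      (𝓝 (Complex.exp ((-(t ^ 2 / 2) : ℝ))))) {f : ℕ → ℝ} {c : ℝ} (hf0 : ∀ n, 0 ≤ f n)
    (hf : ∀ᶠ n in atTop, f n ≤ (Q n : Measure ℝ).real (Set.Ici c)) :
    limsup f atTop ≤ 1 - cdf (gaussianReal 0 1) c := by
  have hlim : Tendsto Q atTop (𝓝 ⟨gaussianReal 0 1, inferInstance⟩) := by
    refine ProbabilityMeasure.tendsto_iff_tendsto_charFun.2 fun t => ?_
    convert h t using 2
    simp [charFun_gaussianReal]
  have := nullSingletonClass_gaussianReal (μ := 0) (v := 1) one_ne_zero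
  have h2 := ProbabilityMeasure.tendsto_measure_of_null_frontier_of_tendsto' hlim
    (E := Set.Ici c) (by rw [frontier_Ici]; simp)
  have h3 : Tendsto (fun n => (Q n : Measure ℝ).real (Set.Ici c)) atTop
      (𝓝 ((gaussianReal 0 1).real (Set.Ici c))) :=
    (ENNReal.tendsto_toReal (measure_ne_top _ _)).comp h2
  rw [gaussianReal_zero_one_real_Ici] at h3
  rw [← h3.limsup_eq]
  refine limsup_le_limsup hf ?_ h3.isBoundedUnder_le
  exact (isBoundedUnder_of ⟨0, hf0⟩ : IsBoundedUnder (· ≥ ·) atTop f).isCoboundedUnder_le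

/-! ### Hidden bias and the sensitivity model of one set -/

theorem PMF.sum_toReal {α : Type*} [Fintype α] (p : PMF α) : ∑ a, (p a).toReal = 1 := by
  rw [← ENNReal.toReal_sum fun a _ => p.apply_ne_top a, ← tsum_fintype (L := .unconditional α),
    p.tsum_coe, ENNReal.toReal_one]

/-- The largest of `m` probabilities is at least `1 / m`, and the smallest is the largest divided by
the bias. For infinite bias the bound is zero. -/
theorem inv_mul_hiddenBias_le {m : ℕ} (p : PMF (Fin m)) (k : Fin m) :
    ((m : ℝ≥0∞) * hiddenBias p)⁻¹ ≤ p k := by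
  refine le_trans ?_ (iInf_le p k)
  rw [← inv_inv (⨅ k, p k), ENNReal.inv_le_inv, hiddenBias, div_eq_mul_inv, ← mul_assoc]
  refine le_mul_of_one_le_left zero_le ?_
  calc (1 : ℝ≥0∞) = ∑ j, p j := by rw [← tsum_fintype (L := .unconditional _), p.tsum_coe]
    _ ≤ ∑ _j : Fin m, ⨆ j, p j := Finset.sum_le_sum fun j _ => le_iSup p j
    _ = m * ⨆ j, p j := by simp

/-- Assignment probabilities whose hidden bias is at most `Γ` belong to the sensitivity model with
bias `Γ`. -/
theorem exists_setModel_of_hiddenBias_le {m : ℕ} (p : PMF (Fin m)) {Γ : ℝ≥0∞} (h1 : 1 ≤ Γ)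
    (h : hiddenBias p ≤ Γ) : ∃ u : Fin m → ℝ, (∀ j, u j ∈ Set.Icc (0 : ℝ) 1) ∧ SetModel Γ u p := by
  by_cases hΓ : Γ = ∞
  · exact ⟨0, fun j => by simp, fun h => absurd hΓ h⟩
  have hne : Nonempty (Fin m) := ⟨p.support_nonempty.some⟩
  obtain ⟨k, hk⟩ := exists_eq_ciInf_of_finite (f := fun j => p j)
  have hle : ∀ j, p j ≤ Γ * p k := fun j => by
    have hmj : p j / p k ≤ Γ := by
      refine le_trans ?_ h
      rw [hiddenBias, ← hk]
      exact ENNReal.div_le_div_right (le_iSup p j) _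
    rcases eq_or_ne (p k) 0 with h0 | h0
    · rcases eq_or_ne (p j) 0 with hj | hj
      · simp [hj]
      · rw [h0, ENNReal.div_zero hj] at hmj
        exact absurd (top_le_iff.1 hmj) hΓ
    · exact (ENNReal.div_le_iff h0 (p.apply_ne_top k)).1 hmj
  have hk0 : p k ≠ 0 := fun h0 => by
    obtain ⟨j, hj⟩ := p.support_nonempty
    have := hle j
    rw [h0, mul_zero] at this
    exact (p.mem_support_iff j).1 hj (le_zero_iff.1 this)
  set g := Γ.toReal with hg
  set r : Fin m → ℝ := fun j => (p j).toReal with hr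
  have hrk : 0 < r k := ENNReal.toReal_pos hk0 (p.apply_ne_top k)
  have hmin : ∀ j, r k ≤ r j := fun j =>
    ENNReal.toReal_mono (p.apply_ne_top j) (hk.trans_le (iInf_le _ j))
  have hmax : ∀ j, r j ≤ g * r k := fun j => by
    have := ENNReal.toReal_mono (ENNReal.mul_ne_top hΓ (p.apply_ne_top k)) (hle j)
    rwa [ENNReal.toReal_mul] at this
  have hg1 : 1 ≤ g := by
    have := ENNReal.toReal_mono hΓ h1
    simpa using this
  have hq1 : ∀ j, 1 ≤ r j / r k := fun j => (one_le_div hrk).2 (hmin j)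
  have hqg : ∀ j, r j / r k ≤ g := fun j => (div_le_iff₀ hrk).2 (hmax j)
  have hlog : 0 ≤ Real.log g := Real.log_nonneg hg1
  -- The confounder is the log-ratio to the least likely unit `k`, in units of `log Γ`. For `Γ = 1`
  -- it is `0` by division by zero, which is right because all ratios are then `1`.
  have hexp : ∀ j, Real.exp (Real.log g * (Real.log (r j / r k) / Real.log g)) = r j / r k := by
    intro j
    have hpos : 0 < r j / r k := one_pos.trans_le (hq1 j)
    rcases hlog.eq_or_lt with h0 | h0
    · have : g = 1 := by
        rcases hg1.eq_or_lt with h | h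
        · exact h.symm
        · exact absurd h0 (Real.log_pos h).ne
      rw [← h0, zero_mul, Real.exp_zero]
      exact le_antisymm (hq1 j) (this ▸ hqg j)
    · rw [mul_div_cancel₀ _ h0.ne', Real.exp_log hpos]
  refine ⟨fun j => Real.log (r j / r k) / Real.log g, fun j => ⟨?_, ?_⟩, fun _ j => ?_⟩
  · exact div_nonneg (Real.log_nonneg (hq1 j)) hlog
  · exact div_le_one_of_le₀ (Real.log_le_log (one_pos.trans_le (hq1 j)) (hqg j)) hlog
  · simp only [← hg, hexp]
    rw [← Finset.sum_div, p.sum_toReal, div_div_div_cancel_right₀ hrk.ne', div_one]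

theorem exists_setModel {m : ℕ} (hm : 0 < m) (Γ : ℝ≥0∞) (u : Fin m → ℝ) :
    ∃ p : PMF (Fin m), ∀ j, (p j).toReal =
      Real.exp (Real.log Γ.toReal * u j) / ∑ k, Real.exp (Real.log Γ.toReal * u k) := by
  have : Nonempty (Fin m) := ⟨⟨0, hm⟩⟩
  set w : Fin m → ℝ := fun j => Real.exp (Real.log Γ.toReal * u j)
  have hw : 0 < ∑ k, w k := Finset.sum_pos (fun k _ => Real.exp_pos _) Finset.univ_nonempty
  have h0 : ∀ j, 0 ≤ w j / ∑ k, w k := fun j => div_nonneg (Real.exp_pos _).le hw.le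
  refine ⟨PMF.ofFintype (fun j => ENNReal.ofReal (w j / ∑ k, w k)) ?_, fun j => ?_⟩
  · rw [← ENNReal.ofReal_sum_of_nonneg fun j _ => h0 j, ← Finset.sum_div, div_self hw.ne',
      ENNReal.ofReal_one]
  · rw [PMF.ofFintype_apply, ENNReal.toReal_ofReal (h0 j)]

/-! ### Means, variances and their maxima -/

namespace MatchedStudy

variable {I : ℕ} (S : MatchedStudy I)

theorem setStat_eq (y : (i : Fin I) → Fin (S.n i) → ℝ) (i : Fin I) (k : Fin (S.n i)) :
    S.setStat y i k = S.q y i k := by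
  simp [setStat, treated]

theorem T_eq_stat_of_fisherNull (h : S.FisherNull) (z : Assignment S.n) :
    S.T z = S.stat z S.Y0 := by
  have : S.observed z = S.Y0 := by
    ext i j
    rw [observed, ← h i j]
    ring
  rw [T, this]

theorem nonempty_units (i : Fin I) : Nonempty (Fin (S.n i)) :=
  ⟨⟨0, by have := S.two_le_n i; omega⟩⟩

theorem setMean_eq_sum (i : Fin I) (p : PMF (Fin (S.n i))) :
    S.setMean i p = ∑ k, (p k).toReal * S.q S.Y0 i k := by
  simp [setMean, PMF.integral_eq_sum, setStat_eq]

theorem setVar_eq_sum (i : Fin I) (p : PMF (Fin (S.n i))) :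
    S.setVar i p = ∑ k, (p k).toReal * (S.q S.Y0 i k - S.setMean i p) ^ 2 := by
  rw [setVar, variance_eq_integral (Measurable.of_discrete).aemeasurable, PMF.integral_eq_sum]
  simp [setMean, setStat_eq]

theorem q_le_iSup (i : Fin I) (k : Fin (S.n i)) : S.q S.Y0 i k ≤ ⨆ j, S.q S.Y0 i j :=
  le_ciSup (Set.finite_range _).bddAbove k

theorem iInf_le_q (i : Fin I) (k : Fin (S.n i)) : ⨅ j, S.q S.Y0 i j ≤ S.q S.Y0 i k :=
  ciInf_le (Set.finite_range _).bddBelow k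

theorem setMean_le_iSup (i : Fin I) (p : PMF (Fin (S.n i))) :
    S.setMean i p ≤ ⨆ j, S.q S.Y0 i j := by
  rw [setMean_eq_sum]
  refine (Finset.sum_le_sum fun k _ =>
    mul_le_mul_of_nonneg_left (S.q_le_iSup i k) ENNReal.toReal_nonneg).trans_eq ?_
  rw [← Finset.sum_mul, p.sum_toReal, one_mul]

theorem iInf_le_setMean (i : Fin I) (p : PMF (Fin (S.n i))) :
    ⨅ j, S.q S.Y0 i j ≤ S.setMean i p := by
  rw [setMean_eq_sum]
  refine Eq.trans_le ?_ (Finset.sum_le_sum fun k _ =>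
    mul_le_mul_of_nonneg_left (S.iInf_le_q i k) ENNReal.toReal_nonneg)
  rw [← Finset.sum_mul, p.sum_toReal, one_mul]

theorem abs_q_sub_setMean_le (i : Fin I) (p : PMF (Fin (S.n i))) (k : Fin (S.n i)) :
    |S.q S.Y0 i k - S.setMean i p| ≤ S.range i := by
  have h1 := S.q_le_iSup i k
  have h2 := S.iInf_le_q i k
  have h3 := S.setMean_le_iSup i p
  have h4 := S.iInf_le_setMean i p
  rw [range, abs_le]
  constructor <;> linarith

theorem setVar_le_sq_range (i : Fin I) (p : PMF (Fin (S.n i))) :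
    S.setVar i p ≤ S.range i ^ 2 := by
  rw [setVar_eq_sum]
  refine (Finset.sum_le_sum fun k _ => mul_le_mul_of_nonneg_left
    (sq_le_sq' (neg_le_of_abs_le (S.abs_q_sub_setMean_le i p k))
      (le_of_abs_le (S.abs_q_sub_setMean_le i p k))) ENNReal.toReal_nonneg).trans_eq ?_
  rw [← Finset.sum_mul, p.sum_toReal, one_mul]

theorem mean_eq_sum (p : (i : Fin I) → PMF (Fin (S.n i))) :
    S.mean p = ∑ i, S.setMean i (p i) := by
  unfold mean stat assignmentLaw setMean
  rw [integral_finsetSum _ fun i _ => Integrable.of_finite]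
  refine Finset.sum_congr rfl fun i _ => ?_
  rw [← (measurePreserving_eval (fun i => (p i).toMeasure) i).map_eq,
    integral_map (measurable_pi_apply i).aemeasurable
      (Measurable.of_discrete).aestronglyMeasurable]

theorem var_eq_sum (p : (i : Fin I) → PMF (Fin (S.n i))) :
    S.var p = ∑ i, S.setVar i (p i) := by
  unfold var setVar assignmentLaw
  rw [← variance_sum_pi fun i => MemLp.of_discrete]
  congr 1
  ext z
  simp [stat]

/-- The set of attainable means of one matched set has a greatest element. -/
theorem exists_setModel_isMax (i : Fin I) (Γ : ℝ≥0∞) :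
    ∃ u p, (∀ j, u j ∈ Set.Icc (0 : ℝ) 1) ∧ SetModel Γ u p ∧
      ∀ u' p', (∀ j, u' j ∈ Set.Icc (0 : ℝ) 1) → SetModel Γ u' p' →
        S.setMean i p' ≤ S.setMean i p := by
  have hn := S.nonempty_units i
  by_cases hΓ : Γ = ∞
  -- An infinite bound imposes no restriction: all mass goes to a unit with the largest score. For
  -- finite `Γ`, the mean is continuous in `u` on a compact cube.
  · obtain ⟨k, hk⟩ := exists_eq_ciSup_of_finite (f := fun j => S.q S.Y0 i j)
    refine ⟨0, PMF.pure k, fun j => by simp, fun h => absurd hΓ h, fun u' p' _ _ => ?_⟩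
    refine (S.setMean_le_iSup i p').trans_eq ?_
    rw [← hk, setMean_eq_sum, Finset.sum_eq_single k]
    · simp
    · intro j _ hj
      simp [hj]
    · simp
  · have hcomp : IsCompact (Set.univ.pi fun _ : Fin (S.n i) => Set.Icc (0 : ℝ) 1) :=
      isCompact_univ_pi fun _ => isCompact_Icc
    obtain ⟨u, hu, hmax⟩ := hcomp.exists_isMaxOn ⟨0, fun _ _ => by simp⟩
      (f := fun u => ∑ j, Real.exp (Real.log Γ.toReal * u j)
        / (∑ k, Real.exp (Real.log Γ.toReal * u k)) * S.q S.Y0 i j)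
      (Continuous.continuousOn (continuous_finsetSum _ fun j _ =>
        (Continuous.div (by fun_prop) (by fun_prop) fun u =>
          (Finset.sum_pos (fun k _ => Real.exp_pos _) Finset.univ_nonempty).ne').mul
            continuous_const))
    obtain ⟨p, hp⟩ := exists_setModel (Fin.pos_iff_nonempty.2 hn) Γ u
    refine ⟨u, p, fun j => hu j trivial, fun _ => hp, fun u' p' hu' hp' => ?_⟩
    simp only [setMean_eq_sum, hp, hp' hΓ]
    exact hmax (a := u') fun j _ => hu' j

theorem setMean_le_setMaxMean {i : Fin I} {Γ : ℝ≥0∞} {u : Fin (S.n i) → ℝ} {p : PMF (Fin (S.n i))}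
    (hu : ∀ j, u j ∈ Set.Icc (0 : ℝ) 1) (hp : SetModel Γ u p) :
    S.setMean i p ≤ S.setMaxMean i Γ := by
  refine le_csSup ⟨⨆ j, S.q S.Y0 i j, ?_⟩ ⟨u, p, hu, hp, rfl⟩
  rintro _ ⟨u', p', _, _, rfl⟩
  exact S.setMean_le_iSup i p'

theorem exists_setMean_eq_setMaxMean (i : Fin I) (Γ : ℝ≥0∞) :
    ∃ u p, (∀ j, u j ∈ Set.Icc (0 : ℝ) 1) ∧ SetModel Γ u p ∧
      S.setMean i p = S.setMaxMean i Γ := by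
  obtain ⟨u, p, hu, hp, hmax⟩ := S.exists_setModel_isMax i Γ
  refine ⟨u, p, hu, hp, le_antisymm (S.setMean_le_setMaxMean hu hp) ?_⟩
  refine csSup_le ⟨_, u, p, hu, hp, rfl⟩ ?_
  rintro _ ⟨u', p', hu', hp', rfl⟩
  exact hmax u' p' hu' hp'

/-- The maximal mean separates into the maximal means of the matched sets. -/
theorem maxMean_eq_sum (Γ : Fin I → ℝ≥0∞) : S.maxMean Γ = ∑ i, S.setMaxMean i (Γ i) := by
  choose u p hu hp h using fun i => S.exists_setMean_eq_setMaxMean i (Γ i)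
  refine IsGreatest.csSup_eq ⟨⟨u, p, hu, hp, ?_⟩, ?_⟩
  · rw [mean_eq_sum]
    exact Finset.sum_congr rfl fun i _ => (h i).symm
  · rintro _ ⟨u', p', hu', hp', rfl⟩
    rw [mean_eq_sum]
    exact Finset.sum_le_sum fun i _ => S.setMean_le_setMaxMean (hu' i) (hp' i)

/-- Set-wise models with maximal mean and nearly maximal variance combine into a joint model with
maximal mean. Near-maximality avoids proving that the variance suprema are attained. -/
theorem sum_setMaxVar_le_maxVar (Γ : Fin I → ℝ≥0∞) :
    ∑ i, S.setMaxVar i (Γ i) ≤ S.maxVar Γ := by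
  refine le_of_forall_pos_le_add fun ε hε => ?_
  -- The `+ 1` keeps the denominator positive when `I = 0`.
  have hδ : 0 < ε / (I + 1) := by positivity
  have hex : ∀ i, ∃ u p, (∀ j, u j ∈ Set.Icc (0 : ℝ) 1) ∧ SetModel (Γ i) u p ∧
      S.setMean i p = S.setMaxMean i (Γ i) ∧
      S.setMaxVar i (Γ i) - ε / (I + 1) < S.setVar i p := by
    intro i
    obtain ⟨u, p, hu, hp, h⟩ := S.exists_setMean_eq_setMaxMean i (Γ i)
    have hlt := sub_lt_self (S.setMaxVar i (Γ i)) hδ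
    generalize S.setMaxVar i (Γ i) - ε / (I + 1) = v at hlt ⊢
    unfold setMaxVar at hlt
    obtain ⟨_, ⟨u', p', hu', hp', h', rfl⟩, hlt⟩ :=
      exists_lt_of_lt_csSup (by exact ⟨_, u, p, hu, hp, h, rfl⟩) hlt
    exact ⟨u', p', hu', hp', h', hlt⟩
  choose u p hu hp hm hv using hex
  have hmem : S.var p ≤ S.maxVar Γ := by
    refine le_csSup ⟨∑ i, S.range i ^ 2, ?_⟩ ⟨u, p, hu, hp, ?_, rfl⟩
    · rintro _ ⟨u', p', _, _, _, rfl⟩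
      rw [var_eq_sum]
      exact Finset.sum_le_sum fun i _ => S.setVar_le_sq_range i _
    · rw [mean_eq_sum, maxMean_eq_sum]
      exact Finset.sum_congr rfl fun i _ => hm i
  rw [var_eq_sum] at hmem
  have hsum := Finset.sum_le_sum fun i (_ : i ∈ Finset.univ) => (hv i).le
  rw [Finset.sum_sub_distrib, Finset.sum_const, Finset.card_univ, Fintype.card_fin,
    nsmul_eq_mul] at hsum
  have : (I : ℝ) * (ε / (I + 1)) ≤ ε := by
    rw [mul_div_assoc', div_le_iff₀ (by positivity)]
    nlinarith
  linarith

/-- The variance of the statistic of one matched set is bounded below by the contribution of that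
set to `rangeSum`. -/
theorem sq_range_mul_le_setVar (i : Fin I) (p : PMF (Fin (S.n i))) :
    S.range i ^ 2 * ((((S.n i : ℝ≥0∞) * hiddenBias p) ^ 3)⁻¹).toReal ≤ S.setVar i p := by
  have hn := S.nonempty_units i
  rw [ENNReal.inv_pow, ENNReal.toReal_pow]
  set w := (((S.n i : ℝ≥0∞) * hiddenBias p)⁻¹).toReal with hw
  have hw0 : 0 ≤ w := ENNReal.toReal_nonneg
  have hwp : ∀ k, w ≤ (p k).toReal := fun k =>
    ENNReal.toReal_mono (p.apply_ne_top k) (inv_mul_hiddenBias_le p k)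
  obtain ⟨a, ha⟩ := exists_eq_ciSup_of_finite (f := fun j => S.q S.Y0 i j)
  obtain ⟨b, hb⟩ := exists_eq_ciInf_of_finite (f := fun j => S.q S.Y0 i j)
  rw [range, ← ha, ← hb, setVar_eq_sum]
  set μ := S.setMean i p
  rcases eq_or_ne a b with rfl | hab
  · rw [sub_self, zero_pow two_ne_zero, zero_mul]
    exact Finset.sum_nonneg fun k _ => mul_nonneg ENNReal.toReal_nonneg (sq_nonneg _)
  · have hpair : ∀ f : Fin (S.n i) → ℝ, (∀ k, 0 ≤ f k) → f a + f b ≤ ∑ k, f k := fun f hf => by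
      rw [← Finset.sum_pair hab]
      exact Finset.sum_le_sum_of_subset_of_nonneg (Finset.subset_univ _) fun k _ _ => hf k
    -- Units `a` and `b` attain the extreme scores and each has probability at least `w`. They alone
    -- contribute at least `w R² / 2` to the variance, and `w ≤ 1 / 2` gives `w³ ≤ w / 2`.
    have hhalf : w ≤ 1 / 2 := by
      have h1 := hpair (fun k => (p k).toReal) fun k => ENNReal.toReal_nonneg
      rw [p.sum_toReal] at h1
      linarith [hwp a, hwp b]
    refine le_trans ?_ (hpair _ fun k => mul_nonneg ENNReal.toReal_nonneg (sq_nonneg _))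
    have h2 := mul_le_mul_of_nonneg_right (hwp a) (sq_nonneg (S.q S.Y0 i a - μ))
    have h3 := mul_le_mul_of_nonneg_right (hwp b) (sq_nonneg (S.q S.Y0 i b - μ))
    have h4 : w ^ 3 ≤ w / 2 := by nlinarith [mul_nonneg hw0 hw0]
    have h5 := mul_le_mul_of_nonneg_left h4 (sq_nonneg (S.q S.Y0 i a - S.q S.Y0 i b))
    have h6 := mul_nonneg hw0 (sq_nonneg ((S.q S.Y0 i a - μ) + (S.q S.Y0 i b - μ)))
    nlinarith

theorem rangeSum_le_var : S.rangeSum ≤ S.var S.p := by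
  rw [var_eq_sum]
  exact Finset.sum_le_sum fun i _ => S.sq_range_mul_le_setVar i (S.p i)

end MatchedStudy

/-! ### The standardized statistic -/

namespace MatchedStudy

variable {I : ℕ} (S : MatchedStudy I)

instance : IsProbabilityMeasure S.law :=
  inferInstanceAs (IsProbabilityMeasure (Measure.pi fun i => (S.p i).toMeasure))

/-- The centred statistic of one matched set, divided by the standard deviation of the test
statistic. -/
noncomputable def standardizedScore (i : Fin I) (k : Fin (S.n i)) : ℝ :=
  (S.q S.Y0 i k - S.setMean i (S.p i)) / Real.sqrt (S.var S.p)

/-- The law of the standardized test statistic. -/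
noncomputable def standardizedLaw : ProbabilityMeasure ℝ :=
  ⟨S.law.map fun z => ∑ i, S.standardizedScore i (z i),
    Measure.isProbabilityMeasure_map (Measurable.of_discrete).aemeasurable⟩

theorem sum_standardizedScore (z : Assignment S.n) :
    ∑ i, S.standardizedScore i (z i) = (S.stat z S.Y0 - S.mean S.p) / Real.sqrt (S.var S.p) := by
  simp only [standardizedScore, ← Finset.sum_div, Finset.sum_sub_distrib, stat, setStat_eq,
    mean_eq_sum]

/-- A deviation in set `i` is at most `R_i`, while the total variance is at least `S_I`; this bound
is the `δ` of the central limit estimate, and it vanishes under (A1). -/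
theorem abs_standardizedScore_le (hS : 0 < S.rangeSum) (i : Fin I) (k : Fin (S.n i)) :
    |S.standardizedScore i k| ≤ Real.sqrt ((⨆ i, S.range i ^ 2) / S.rangeSum) := by
  refine Real.abs_le_sqrt ?_
  have hv := hS.trans_le S.rangeSum_le_var
  rw [standardizedScore, div_pow, Real.sq_sqrt hv.le]
  have h1 := S.abs_q_sub_setMean_le i (S.p i) k
  have h2 : (S.q S.Y0 i k - S.setMean i (S.p i)) ^ 2 ≤ ⨆ i, S.range i ^ 2 :=
    (sq_le_sq' (neg_le_of_abs_le h1) (le_of_abs_le h1)).trans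
      (le_ciSup (f := fun i => S.range i ^ 2) (Set.finite_range _).bddAbove i)
  exact div_le_div₀ ((sq_nonneg _).trans h2) h2 hS S.rangeSum_le_var

theorem norm_charFun_standardizedLaw_sub_le (hS : 0 < S.rangeSum) {t : ℝ}
    (ht : |t| * Real.sqrt ((⨆ i, S.range i ^ 2) / S.rangeSum) ≤ 1) :
    ‖charFun (S.standardizedLaw : Measure ℝ) t - Complex.exp ((-(t ^ 2 / 2) : ℝ))‖
      ≤ |t| ^ 3 * Real.sqrt ((⨆ i, S.range i ^ 2) / S.rangeSum)
        + t ^ 4 * Real.sqrt ((⨆ i, S.range i ^ 2) / S.rangeSum) ^ 2 := by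
  have hv := hS.trans_le S.rangeSum_le_var
  have hchar : charFun (S.standardizedLaw : Measure ℝ) t
      = ∫ z, Complex.exp ((t * ∑ i, S.standardizedScore i (z i) : ℝ) * Complex.I)
        ∂(Measure.pi fun i => (S.p i).toMeasure) := by
    rw [charFun_apply_real, standardizedLaw, ProbabilityMeasure.coe_mk,
      integral_map (Measurable.of_discrete).aemeasurable (by fun_prop)]
    push_cast
    rfl
  rw [hchar]
  refine norm_integral_cexp_sum_sub_le (fun i => (S.p i).toMeasure)
    (fun i => Measurable.of_discrete) (S.abs_standardizedScore_le hS) (Real.sqrt_nonneg _)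
    (fun i => ?_) ?_ ht
  · have h : S.setMean i (S.p i) = ∑ k, (S.p i k).toReal * S.q S.Y0 i k := S.setMean_eq_sum i _
    simp only [PMF.integral_eq_sum, standardizedScore, smul_eq_mul, mul_div_assoc']
    rw [← Finset.sum_div]
    simp only [mul_sub, Finset.sum_sub_distrib]
    rw [← Finset.sum_mul, PMF.sum_toReal, one_mul, ← h, sub_self, zero_div]
  · simp only [PMF.integral_eq_sum, standardizedScore, smul_eq_mul, div_pow, Real.sq_sqrt hv.le,
      mul_div_assoc']
    simp only [← Finset.sum_div, ← setVar_eq_sum]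
    rw [← var_eq_sum, div_self hv.ne']

/-! ### Comparing true and maximized moments -/

variable {S} {Γ : Fin I → ℝ≥0∞}

theorem setMean_le_setMaxMean_of_hiddenBias_le (hΓ : ∀ i, 1 ≤ Γ i)
    (hbias : ∀ i, hiddenBias (S.p i) ≤ Γ i) (i : Fin I) :
    S.setMean i (S.p i) ≤ S.setMaxMean i (Γ i) := by
  obtain ⟨u, hu, hp⟩ := exists_setModel_of_hiddenBias_le (S.p i) (hΓ i) (hbias i)
  exact S.setMean_le_setMaxMean hu hp

/-- The excess of the true standard deviation over the maximized one is compensated by the excess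
of the maximal mean over the true mean. -/
theorem mul_sqrt_var_le (hΓ : ∀ i, 1 ≤ Γ i) (hbias : ∀ i, hiddenBias (S.p i) ≤ Γ i)
    (hS : 0 < S.rangeSum) {c : ℝ} (hc : 0 ≤ c)
    (hratio : (c : EReal) < S.deltaRatio Γ * ((Real.sqrt S.rangeSum : ℝ) : EReal)) :
    c * Real.sqrt (S.var S.p) ≤ S.maxMean Γ - S.mean S.p + c * Real.sqrt (S.maxVar Γ) := by
  classical
  have hmean := setMean_le_setMaxMean_of_hiddenBias_le hΓ hbias
  have hv := hS.trans_le S.rangeSum_le_var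
  have hM : S.maxMean Γ - S.mean S.p = ∑ i, (S.setMaxMean i (Γ i) - S.setMean i (S.p i)) := by
    rw [maxMean_eq_sum, mean_eq_sum, Finset.sum_sub_distrib]
  have hM0 : 0 ≤ S.maxMean Γ - S.mean S.p := by
    rw [hM]
    exact Finset.sum_nonneg fun i _ => sub_nonneg.2 (hmean i)
  rcases le_or_gt (S.var S.p) (S.maxVar Γ) with hle | hlt
  · have := mul_le_mul_of_nonneg_left (Real.sqrt_le_sqrt hle) hc
    linarith
  have hD : S.var S.p - S.maxVar Γ ≤ ∑ i, (S.setVar i (S.p i) - S.setMaxVar i (Γ i)) := by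
    have := S.sum_setMaxVar_le_maxVar Γ
    rw [Finset.sum_sub_distrib, ← var_eq_sum]
    linarith
  set A := (S.excess Γ).toFinset with hA
  have hmemA : ∀ i, i ∈ A ↔ S.setMaxVar i (Γ i) < S.setVar i (S.p i) := fun i => by
    rw [hA, Set.mem_toFinset]
    rfl
  set Dt := ∑ i ∈ A, (S.setVar i (S.p i) - S.setMaxVar i (Γ i)) with hDt
  set Mt := ∑ i ∈ A, (S.setMaxMean i (Γ i) - S.setMean i (S.p i)) with hMt
  have hDA : S.var S.p - S.maxVar Γ ≤ Dt := by
    refine hD.trans ?_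
    rw [← Finset.sum_add_sum_compl A]
    have : ∑ i ∈ Aᶜ, (S.setVar i (S.p i) - S.setMaxVar i (Γ i)) ≤ 0 :=
      Finset.sum_nonpos fun i hi => by
        rw [Finset.mem_compl, hmemA, not_lt] at hi
        linarith
    linarith
  have hMA : Mt ≤ S.maxMean Γ - S.mean S.p := by
    rw [hM]
    exact Finset.sum_le_sum_of_subset_of_nonneg (Finset.subset_univ _) fun i _ _ =>
      sub_nonneg.2 (hmean i)
  have hMt0 : 0 ≤ Mt := Finset.sum_nonneg fun i _ => sub_nonneg.2 (hmean i)
  -- In this case `A` cannot be empty, so the conventional value `∞` of the ratio does not occur;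
  -- the factors `1 / |A|` cancel below.
  have hDt0 : 0 < Dt := lt_of_lt_of_le (by linarith) hDA
  have hne : S.excess Γ ≠ ∅ := by
    intro h
    have : A = ∅ := by simp [hA, h]
    rw [hDt, this, Finset.sum_empty] at hDt0
    exact hDt0.false
  have hcard : (A.card : ℝ)⁻¹ ≠ 0 := by
    refine inv_ne_zero ?_
    rw [Nat.cast_ne_zero, Finset.card_ne_zero, hA, Set.toFinset_nonempty]
    exact Set.nonempty_iff_ne_empty.2 hne
  have hdiv : S.deltaMean Γ / S.deltaVar Γ = Mt / Dt := by
    have h1 : S.deltaMean Γ = (A.card : ℝ)⁻¹ * Mt := by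
      simp only [deltaMean, hMt, hA]
    have h2 : S.deltaVar Γ = (A.card : ℝ)⁻¹ * Dt := by
      simp only [deltaVar, hDt, hA]
    rw [h1, h2, mul_div_mul_left _ _ hcard]
  rw [deltaRatio, if_neg hne, hdiv, ← EReal.coe_mul, EReal.coe_lt_coe_iff, div_mul_eq_mul_div,
    lt_div_iff₀ hDt0] at hratio
  set s := Real.sqrt (S.var S.p) with hs
  set σ := Real.sqrt (S.maxVar Γ) with hσ
  have hs0 : 0 < s := Real.sqrt_pos.2 hv
  have hσ0 : 0 ≤ σ := Real.sqrt_nonneg _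
  have hσs : σ ≤ s := Real.sqrt_le_sqrt hlt.le
  have hss : s ^ 2 = S.var S.p := Real.sq_sqrt hv.le
  have hMs : c * Dt ≤ Mt * s :=
    hratio.le.trans (mul_le_mul_of_nonneg_left (Real.sqrt_le_sqrt S.rangeSum_le_var) hMt0)
  -- Nonnegativity of `maxVar` is not needed: `σ ^ 2 ≥ maxVar` suffices.
  have hσσ : σ ^ 2 = max (S.maxVar Γ) 0 := by
    exact Real.sq_sqrt' 
  have hcD : c * (s ^ 2 - σ ^ 2) ≤ c * Dt := by
    refine mul_le_mul_of_nonneg_left ?_ hc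
    have := le_max_left (S.maxVar Γ) 0
    rw [hss, hσσ]
    linarith
  have hcσ : c * (σ * σ) ≤ c * (σ * s) :=
    mul_le_mul_of_nonneg_left (mul_le_mul_of_nonneg_left hσs hσ0) hc
  -- From `c (s² - σ²) ≤ Mt s` and `σ² ≤ σ s`; dividing by `s` gives the claim.
  have hfin : (c * s) * s ≤ (Mt + c * σ) * s := by nlinarith
  have := le_of_mul_le_mul_right hfin hs0
  linarith

end MatchedStudy

/-! ### The limiting tail bound -/

/-- A sequence of matched studies, the `I`-th with `I` matched sets, and bounds `Γ I`. -/
theorem theorem4 (S : (I : ℕ) → MatchedStudy I) (Γ : (I : ℕ) → Fin I → ℝ≥0∞)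
    (hΓ : ∀ I i, 1 ≤ Γ I i)
    (hnull : ∀ I, (S I).FisherNull)
    (hbias : ∀ I i, hiddenBias ((S I).p i) ≤ Γ I i)
    (hA1 : ConditionA1 S) (hA2 : ConditionA2 S Γ) (c : ℝ) (hc : 0 ≤ c) :
    limsup (fun I => (S I).law.real
        {z | (S I).T z ≥ (S I).maxMean (Γ I) + c * Real.sqrt ((S I).maxVar (Γ I))}) atTop
      ≤ 1 - cdf (gaussianReal 0 1) c ∧
    ∀ I, 0 < (S I).maxVar (Γ I) →
      (gaussianReal ((S I).maxMean (Γ I)) ((S I).maxVar (Γ I)).toNNReal).real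
        {t | t ≥ (S I).maxMean (Γ I) + c * Real.sqrt ((S I).maxVar (Γ I))}
      = 1 - cdf (gaussianReal 0 1) c := by
  refine ⟨limsup_real_tail_le (Q := fun I => (S I).standardizedLaw) (fun t => ?_)
    (fun I => measureReal_nonneg) ?_, fun I hI => gaussianReal_real_upper_tail _ hI c⟩
  · have hδ := (Real.continuous_sqrt.tendsto 0).comp hA1.2
    rw [Real.sqrt_zero] at hδ
    have hsmall : ∀ᶠ I in atTop,
        |t| * Real.sqrt ((⨆ i, (S I).range i ^ 2) / (S I).rangeSum) ≤ 1 := by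
      have h := hδ.const_mul |t|
      rw [mul_zero] at h
      exact (h.eventually_lt_const one_pos).mono fun I hI => hI.le
    rw [tendsto_iff_norm_sub_tendsto_zero]
    refine squeeze_zero' (Eventually.of_forall fun I => norm_nonneg _)
      (g := fun I => |t| ^ 3 * Real.sqrt ((⨆ i, (S I).range i ^ 2) / (S I).rangeSum)
        + t ^ 4 * Real.sqrt ((⨆ i, (S I).range i ^ 2) / (S I).rangeSum) ^ 2) ?_ ?_
    · filter_upwards [hA1.1, hsmall] with I hI ht
      exact (S I).norm_charFun_standardizedLaw_sub_le hI ht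
    · simpa using (hδ.const_mul (|t| ^ 3)).add ((hδ.pow 2).const_mul (t ^ 4))
  -- Of (A2) only this is used: the product eventually exceeds the fixed `c`. The rejection event
  -- then lies in the standardized tail beyond `c`.
  · have hratio := hA2.eventually (lt_mem_nhds (EReal.coe_lt_top c))
    filter_upwards [hA1.1, hratio] with I hI hr
    have hv := Real.sqrt_pos.2 (hI.trans_le (S I).rangeSum_le_var)
    have hkey := MatchedStudy.mul_sqrt_var_le (hΓ I) (hbias I) hI hc hr
    rw [MatchedStudy.standardizedLaw, ProbabilityMeasure.coe_mk,
      map_measureReal_apply Measurable.of_discrete measurableSet_Ici]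
    refine measureReal_mono fun z hz => ?_
    rw [Set.mem_ofPred_eq, (S I).T_eq_stat_of_fisherNull (hnull I)] at hz
    rw [Set.mem_preimage, Set.mem_Ici, MatchedStudy.sum_standardizedScore, le_div_iff₀ hv]
    linarith
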